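/- Let $(X,\mathfrak A,\mu)$ be a $\sigma$-finite measure space and let $L^0(X,\mu)$ be the space of $\mu$-a.e. equivalence classes of measurable functions $X\to\mathbb R$, with the topology of local convergence in measure (convergence in measure on every set of finite measure). Let $q\colon L^2(X,\mu)\to[0,\infty]$ be a quadratic form with domain $D(q)=\{f\in L^2(X,\mu) : q(f)<\infty\}$ (not necessarily dense). Assume that $q$ is closed, i.e. $D(q)$ is complete with respect to the metric $q(f-g)^{1/2}+\|f-g\|_2$, and that $q$ satisfies the first Beurling–Deny criterion $q(|f|)\le q(f)$ for all $f\in L^2(X,\mu)$. Let $q_e\colon L^0(X,\mu)\to[0,\infty]$ be the extended form of $q$, i.e. its closure on $L^0(X,\mu)$: $q_e(f)=\lim_{n\to\infty}q(f_n)$ if there is a $q$-Cauchy sequence $(f_n)$ in $D(q)$ with $f_n\to f$ in $L^0(X,\mu)$, and $q_e(f)=\infty$ otherwise (the limit does not depend on the choice of the sequence). Let $D(q_e)=\{f\in L^0(X,\mu) : q_e(f)<\infty\}$ and $\ker q_e=\{f\in L^0(X,\mu) : q_e(f)=0\}$. Suppose that $\ker q_e=\{0\}$. Let $h\in L^0(X,\mu)$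 be strictly positive ($\mu$-a.e.), and let $w\in L^1(X,(1+h^2)\mu)$ be strictly positive ($\mu$-a.e.). Then there is a decreasing (i.e. non-increasing) function $\alpha\colon(0,\infty)\to(0,\infty)$ such that for all $r>0$ and all $f\in D(q_e)$ $$\int_X |f|^2\,w\,d\mu\;\le\;\alpha(r)\,q_e(f)+r\,\|f/h\|_\infty^2 ,$$ where $\|f/h\|_\infty\in[0,\infty]$ is the essential supremum of $|f/h|$ with respect to $\mu$ (the right-hand side is $\infty$ if it is infinite). -/

import Mathlib

open MeasureTheory Filter Topology Set
open scoped ENNReal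

/-- A quadratic form `q : E → [0, ∞]` on a real vector space (with the convention `0 * ∞ = 0`).
Its domain is `{f | q f < ∞}`. -/
structure IsQuadForm {E : Type*} [AddCommGroup E] [Module ℝ E] (q : E → ℝ≥0∞) : Prop where
  smul : ∀ (c : ℝ) (f : E), q (c • f) = ENNReal.ofReal (c ^ 2) * q f
  parallelogram : ∀ f g : E, q (f + g) + q (f - g) = 2 * q f + 2 * q g

/-- The metric `q (f - g) ^ (1/2) + ‖f - g‖` of the form topology. -/
noncomputable def formDist {E : Type*} [NormedAddCommGroup E] (q : E → ℝ≥0∞) (f g : E) : ℝ≥0∞ :=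
  q (f - g) ^ (1 / 2 : ℝ) + ‖f - g‖ₑ

/-- The form is closed: its domain is complete with respect to `formDist q`. -/
def IsClosedForm {E : Type*} [NormedAddCommGroup E] (q : E → ℝ≥0∞) : Prop :=
  ∀ u : ℕ → E, (∀ n, q (u n) < ∞) →
    (∀ ε : ℝ≥0∞, 0 < ε → ∃ N : ℕ, ∀ m ≥ N, ∀ n ≥ N, formDist q (u m) (u n) < ε) →
    ∃ f : E, q f < ∞ ∧ Tendsto (fun n => formDist q (u n) f) atTop (𝓝 0)

/-- The first Beurling-Deny criterion for a form on `L²(X, μ)`. -/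
def FirstBeurlingDeny {X : Type*} [MeasurableSpace X] {μ : Measure X}
    (q : Lp ℝ 2 μ → ℝ≥0∞) : Prop :=
  ∀ f : Lp ℝ 2 μ, q |f| ≤ q f

/-- Convergence of a sequence in `L⁰(X, μ)`: local convergence in measure, that is, convergence
in measure on every set of finite measure. -/
def TendstoL0 {X : Type*} [MeasurableSpace X] {μ : Measure X}
    (u : ℕ → X →ₘ[μ] ℝ) (f : X →ₘ[μ] ℝ) : Prop :=
  ∀ s : Set X, MeasurableSet s → μ s < ∞ →
    TendstoInMeasure (μ.restrict s) (fun n => (u n : X → ℝ)) atTop (f : X → ℝ)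

/-- A sequence in the domain of `q` that is Cauchy with respect to `q`. -/
def IsFormCauchy {E : Type*} [AddCommGroup E] (q : E → ℝ≥0∞) (u : ℕ → E) : Prop :=
  (∀ n, q (u n) < ∞) ∧
    ∀ ε : ℝ≥0∞, 0 < ε → ∃ N : ℕ, ∀ m ≥ N, ∀ n ≥ N, q (u m - u n) < ε

/-- The extended form `q_e` of a form `q` on `L²(X, μ)`, that is, its closure on `L⁰(X, μ)`:
`q_e f = lim q (u n)` if there is a `q`-Cauchy sequence `u` in the domain of `q` that converges
to `f` in `L⁰(X, μ)`, and `q_e f = ∞` if there is none.  Along a `q`-Cauchy sequence the limit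
exists, so that it is the `liminf`; it is the same for all such sequences when `q` is closable on
`L⁰(X, μ)`, so that the infimum over them is the common value. -/
noncomputable def extendedForm {X : Type*} [MeasurableSpace X] {μ : Measure X}
    (q : Lp ℝ 2 μ → ℝ≥0∞) (f : X →ₘ[μ] ℝ) : ℝ≥0∞ :=
  ⨅ (u : ℕ → Lp ℝ 2 μ) (_ : IsFormCauchy q u)
    (_ : TendstoL0 (fun n => (u n : X →ₘ[μ] ℝ)) f), liminf (fun n => q (u n)) atTop

open MeasureTheory Filter Topology Set
open scoped ENNReal

namespace IsQuadForm

variable {E : Type*} [AddCommGroup E] [Module ℝ E] {q : E → ℝ≥0∞}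

/-! Fix `r`. By homogeneity, compare functions with `|g| ≤ h`: if such `g` are close in measure to
functions `u` of small energy, then `∫ g² w` is small (`exists_lintegral_lt_of_form_le`). Otherwise
there are `g n`, `u n` with `q (u n) ≤ 2⁻ⁿ` and `|u n| - |g n| → 0` a.e. The energies of finite
suprema add up, so `limsup |u n|` is an `L⁰` limit of functions whose energy tends to `0`; it lies
in the kernel of the extended form and vanishes (`ae_tendsto_zero_of_form_le`). Dominated
convergence with majorant `h² w` gives a contradiction. For general `f` with `M = ‖f/h‖_∞`, either
the energy of `f` is at least `M² δ` and pays for `∫ f² w ≤ M² ∫ h² w`, or `f / M` falls under the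
case above. -/

lemma sub_le (hq : IsQuadForm q) (f g : E) : q (f - g) ≤ 2 * q f + 2 * q g :=
  le_add_self.trans (hq.parallelogram f g).le

end IsQuadForm

/-! ### Energy of finite suprema -/

section Lattice

variable {X : Type*} [MeasurableSpace X] {μ : Measure X} {q : Lp ℝ 2 μ → ℝ≥0∞}

/-- A quadratic form with the first Beurling-Deny criterion is subadditive on suprema. -/
lemma FirstBeurlingDeny.sup_le (hBD : FirstBeurlingDeny q) (hq : IsQuadForm q)
    (f g : Lp ℝ 2 μ) : q (f ⊔ g) ≤ q f + q g := by
  have hfour : ENNReal.ofReal ((2⁻¹ : ℝ) ^ 2) * 4 = 1 := by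
    rw [show (4 : ℝ≥0∞) = ENNReal.ofReal 4 by norm_num, ← ENNReal.ofReal_mul (by positivity)]
    norm_num
  -- This is the energy of `2 (f ⊔ g)`; the parallelogram identity is used twice, with Beurling-Deny
  -- in between.
  have hle : q (f + g + |g - f|) ≤ 4 * (q f + q g) := calc
    q (f + g + |g - f|) ≤ 2 * q (f + g) + 2 * q |g - f| :=
      le_self_add.trans (hq.parallelogram _ _).le
    _ ≤ 2 * q (g + f) + 2 * q (g - f) := by
      rw [add_comm f g]; gcongr; exact hBD _
    _ = 2 * (q (g + f) + q (g - f)) := by ring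
    _ = 4 * (q f + q g) := by rw [hq.parallelogram]; ring
  rw [sup_eq_half_smul_add_add_abs_sub' ℝ, hq.smul]
  calc _ ≤ ENNReal.ofReal ((2⁻¹ : ℝ) ^ 2) * (4 * (q f + q g)) := by gcongr
    _ = q f + q g := by rw [← mul_assoc, hfour, one_mul]

lemma FirstBeurlingDeny.partialSups_le (hBD : FirstBeurlingDeny q) (hq : IsQuadForm q)
    (u : ℕ → Lp ℝ 2 μ) (k : ℕ) :
    q (partialSups u k) ≤ ∑ i ∈ Finset.range (k + 1), q (u i) := by
  induction k with
  | zero => simp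
  | succ k ih =>
    rw [Finset.sum_range_succ, ← Order.succ_eq_add_one k, partialSups_succ]
    exact (hBD.sup_le hq _ _).trans (add_le_add_left ih _)

lemma coeFn_partialSups (u : ℕ → Lp ℝ 2 μ) :
    ∀ᵐ x ∂μ, ∀ k, (partialSups u k : Lp ℝ 2 μ) x = partialSups (fun n => u n x) k := by
  rw [ae_all_iff]
  intro k
  induction k with
  | zero => simp
  | succ k ih =>
    rw [← Order.succ_eq_add_one k, partialSups_succ]
    filter_upwards [ih, Lp.coeFn_sup (partialSups u k) (u (Order.succ k))] with x h1 h2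
    rw [partialSups_succ, h2, Pi.sup_apply, h1]

end Lattice

/-! ### Convergence in measure and almost everywhere -/

section Convergence

variable {X : Type*} [MeasurableSpace X] {μ ν : Measure X}

lemma tendstoL0_of_tendsto_ae {u : ℕ → X →ₘ[μ] ℝ} {f : X →ₘ[μ] ℝ}
    (h : ∀ᵐ x ∂μ, Tendsto (fun n => u n x) atTop (𝓝 (f x))) : TendstoL0 u f := by
  intro s _ hs
  have : IsFiniteMeasure (μ.restrict s) := ⟨by simpa using hs⟩
  exact tendstoInMeasure_of_tendsto_ae
    (fun n => (u n).aestronglyMeasurable.mono_measure Measure.restrict_le_self)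
    (ae_restrict_of_ae h)

/-- A sequence converging in `L⁰(μ)` comes close to its limit with respect to any finite
absolutely continuous measure. -/
lemma TendstoL0.exists_measure_le [SigmaFinite μ] [IsFiniteMeasure ν] (hν : ν ≪ μ)
    {u : ℕ → X →ₘ[μ] ℝ} {f : X →ₘ[μ] ℝ} (h : TendstoL0 u f) {ε δ : ℝ≥0∞} (hε : 0 < ε)
    (hδ : 0 < δ) : ∃ k, ν {x | ε ≤ edist (u k x) (f x)} ≤ δ := by
  have hδ2 : 0 < δ / 2 := ENNReal.half_pos hδ.ne'
  obtain ⟨j, hj⟩ : ∃ j, ν (spanningSets μ j)ᶜ ≤ δ / 2 := by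
    have := tendsto_measure_iInter_atTop (μ := ν) (s := fun j => (spanningSets μ j)ᶜ)
      (fun j => (measurableSet_spanningSets μ j).compl.nullMeasurableSet)
      (fun i j hij => compl_subset_compl.2 (monotone_spanningSets μ hij))
      ⟨0, measure_ne_top _ _⟩
    rw [← compl_iUnion, iUnion_spanningSets, compl_univ, measure_empty] at this
    exact (this.eventually (ge_mem_nhds hδ2)).exists
  set S := spanningSets μ j
  -- Convergence in measure is carried from `μ` to `ν` through an a.e. convergent subsequence.
  obtain ⟨ns, -, hns⟩ := (h S (measurableSet_spanningSets μ j)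
    (measure_spanningSets_lt_top μ j)).exists_seq_tendsto_ae
  have hin : TendstoInMeasure (ν.restrict S) (fun i => (u (ns i) : X → ℝ)) atTop f :=
    tendstoInMeasure_of_tendsto_ae
      (fun n => ((u (ns n)).aestronglyMeasurable.mono_ac hν).mono_measure
        Measure.restrict_le_self)
      ((hν.restrict S).ae_le hns)
  obtain ⟨i, hi⟩ := ((hin ε hε).eventually (ge_mem_nhds hδ2)).exists
  refine ⟨ns i, ?_⟩
  set A := {x | ε ≤ edist (u (ns i) x) (f x)}
  calc ν A ≤ ν (A ∩ S) + ν (A \ S) := measure_le_inter_add_sdiff _ _ _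
    _ ≤ δ / 2 + δ / 2 := by
      gcongr
      · rwa [Measure.restrict_apply' (measurableSet_spanningSets μ j)] at hi
      · exact (measure_mono fun x hx => hx.2).trans hj
    _ = δ := ENNReal.add_halves δ

lemma tsum_two_inv_pow : ∑' n : ℕ, (2⁻¹ : ℝ≥0∞) ^ n = 2 := by
  rw [ENNReal.tsum_geometric, ENNReal.one_sub_inv_two, inv_inv]

lemma tendsto_two_inv_pow : Tendsto (fun n : ℕ => (2⁻¹ : ℝ≥0∞) ^ n) atTop (𝓝 0) :=
  ENNReal.tendsto_pow_atTop_nhds_zero_of_lt_one (by simp [ENNReal.inv_lt_one])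

/-- Borel-Cantelli, the exceptional sets having summable measure. -/
lemma ae_tendsto_edist_of_measure_le {a b : ℕ → X → ℝ}
    (h : ∀ n, ν {x | (2⁻¹ : ℝ≥0∞) ^ n ≤ edist (a n x) (b n x)} ≤ 2⁻¹ ^ n) :
    ∀ᵐ x ∂ν, Tendsto (fun n => edist (a n x) (b n x)) atTop (𝓝 0) := by
  have hsum : ∑' n, ν {x | (2⁻¹ : ℝ≥0∞) ^ n ≤ edist (a n x) (b n x)} ≠ ∞ :=
    ne_top_of_le_ne_top (by rw [tsum_two_inv_pow]; simp) (ENNReal.tsum_le_tsum h)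
  filter_upwards [ae_eventually_notMem hsum] with x hx
  refine tendsto_of_tendsto_of_tendsto_of_le_of_le' tendsto_const_nhds tendsto_two_inv_pow
    (.of_forall fun _ => zero_le) ?_
  filter_upwards [hx] with n hn
  exact (not_le.1 hn).le

end Convergence

/-! ### Vanishing energy forces convergence to zero -/

section Main

variable {X : Type*} [MeasurableSpace X] {μ : Measure X} {q : Lp ℝ 2 μ → ℝ≥0∞}

lemma exists_isFormCauchy_of_extendedForm_lt {f : X →ₘ[μ] ℝ} {c : ℝ≥0∞}
    (h : extendedForm q f < c) :
    ∃ u : ℕ → Lp ℝ 2 μ, (∀ n, q (u n) < c) ∧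
      TendstoL0 (fun n => (u n : X →ₘ[μ] ℝ)) f := by
  simp only [extendedForm, iInf_lt_iff] at h
  obtain ⟨u, -, hu, hlt⟩ := h
  obtain ⟨φ, hφ, hφq⟩ := extraction_of_frequently_atTop
    (frequently_lt_of_liminf_lt (by isBoundedDefault) hlt)
  exact ⟨u ∘ φ, hφq, fun s hs hs' => (hu s hs hs').comp hφ.tendsto_atTop⟩

lemma extendedForm_eq_zero_of_tendsto (hq : IsQuadForm q) {v : ℕ → Lp ℝ 2 μ} {f : X →ₘ[μ] ℝ}
    (hv : ∀ n, q (v n) < ∞) (hv0 : Tendsto (fun n => q (v n)) atTop (𝓝 0))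
    (hf : TendstoL0 (fun n => (v n : X →ₘ[μ] ℝ)) f) : extendedForm q f = 0 := by
  have hC : IsFormCauchy q v := by
    refine ⟨hv, fun ε hε => ?_⟩
    have hε5 : 0 < ε / 5 := ENNReal.div_pos hε.ne' (by simp)
    rcases eq_or_ne ε ∞ with rfl | hεt
    · refine ⟨0, fun m _ n _ => (hq.sub_le _ _).trans_lt ?_⟩
      exact ENNReal.add_lt_top.2 ⟨ENNReal.mul_lt_top (by simp) (hv m),
        ENNReal.mul_lt_top (by simp) (hv n)⟩
    obtain ⟨N, hN⟩ := eventually_atTop.1 (hv0.eventually (ge_mem_nhds hε5))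
    refine ⟨N, fun m hm n hn => (hq.sub_le _ _).trans_lt ?_⟩
    calc 2 * q (v m) + 2 * q (v n) ≤ 2 * (ε / 5) + 2 * (ε / 5) := by
          gcongr
          · exact hN m hm
          · exact hN n hn
      _ = ε * (4 / 5) := by simp only [div_eq_mul_inv]; ring
      _ < ε * 1 := by
        rw [ENNReal.mul_lt_mul_iff_right hε.ne' hεt]
        exact ENNReal.div_lt_of_lt_mul' (by norm_num)
      _ = ε := mul_one ε
  refine le_antisymm ?_ zero_le
  rw [extendedForm, ← hv0.liminf_eq]
  exact iInf_le_of_le v (iInf_le_of_le hC (iInf_le _ hf))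

/-- If nonnegative functions in the domain of the form are summable in energy and pointwise
bounded, then they converge to zero, provided that the extended form has trivial kernel. -/
lemma ae_tendsto_zero_of_form_le [SigmaFinite μ] (hq : IsQuadForm q) (hBD : FirstBeurlingDeny q)
    (hker : ∀ f : X →ₘ[μ] ℝ, extendedForm q f = 0 → f = 0) {u : ℕ → Lp ℝ 2 μ}
    (hu : ∀ n, q (u n) ≤ 2⁻¹ ^ n) (hpos : ∀ᵐ x ∂μ, ∀ n, 0 ≤ u n x)
    (hbdd : ∀ᵐ x ∂μ, BddAbove (range fun n => u n x)) :
    ∀ᵐ x ∂μ, Tendsto (fun n => u n x) atTop (𝓝 0) := by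
  -- The tail supremum `G m` need not lie in `L²`, hence its approximation by the finite suprema `S
  -- m k`.
  let S : ℕ → ℕ → Lp ℝ 2 μ := fun m => partialSups fun k => u (m + k)
  let G : ℕ → X → ℝ := fun m x => ⨆ k, u (m + k) x
  have hbdd' : ∀ᵐ x ∂μ, ∀ m, BddAbove (range fun k => u (m + k) x) := by
    filter_upwards [hbdd] with x hx m
    exact hx.mono (range_comp_subset_range (fun k => m + k) fun n => u n x)
  have hSG : ∀ᵐ x ∂μ, ∀ m, Tendsto (fun k => S m k x) atTop (𝓝 (G m x)) := by
    have hS : ∀ᵐ x ∂μ, ∀ m k, S m k x = partialSups (fun k => u (m + k) x) k :=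
      ae_all_iff.2 fun m => coeFn_partialSups fun k => u (m + k)
    filter_upwards [hS, hbdd'] with x hx hb m
    simp_rw [hx m]
    have := tendsto_atTop_ciSup (partialSups fun k => u (m + k) x).monotone
      (bddAbove_range_partialSups.2 (hb m))
    rwa [ciSup_partialSups_eq (hb m)] at this
  -- `μ.toFinite` is a finite measure with the same null sets, so a.e. convergence implies
  -- convergence in measure for it.
  have hac : μ.toFinite ≪ μ := toFinite_absolutelyContinuous μ
  have hk : ∀ m, ∃ k, μ.toFinite {x | (2⁻¹ : ℝ≥0∞) ^ m ≤ edist (S m k x) (G m x)} ≤ 2⁻¹ ^ m := by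
    intro m
    have hpos : (0 : ℝ≥0∞) < 2⁻¹ ^ m := ENNReal.pow_pos (by simp) m
    have hin : TendstoInMeasure μ.toFinite (fun k => (S m k : X → ℝ)) atTop (G m) :=
      tendstoInMeasure_of_tendsto_ae (fun k => (Lp.aestronglyMeasurable _).mono_ac hac)
        (hac.ae_le (hSG.mono fun x hx => hx m))
    exact ((hin _ hpos).eventually (ge_mem_nhds hpos)).exists
  choose k hk using hk
  let v : ℕ → Lp ℝ 2 μ := fun m => S m (k m)
  let g : X → ℝ := fun x => ⨅ m, G m x
  have hG0 : ∀ᵐ x ∂μ, ∀ m, 0 ≤ G m x := by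
    filter_upwards [hpos] with x hx m
    exact Real.iSup_nonneg fun k => hx _
  have huG : ∀ᵐ x ∂μ, ∀ m, u m x ≤ G m x := by
    filter_upwards [hbdd'] with x hx m
    exact le_ciSup (hx m) 0
  have hGg : ∀ᵐ x ∂μ, Tendsto (fun m => G m x) atTop (𝓝 (g x)) := by
    filter_upwards [hG0, hbdd'] with x h0 hb
    refine tendsto_atTop_ciInf (fun m n hmn => ciSup_le fun j => ?_)
      ⟨0, forall_mem_range.2 h0⟩
    refine le_ciSup_of_le (hb m) (n - m + j) (le_of_eq ?_)
    rw [← add_assoc, Nat.add_sub_cancel' hmn]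
  have hvg : ∀ᵐ x ∂μ, Tendsto (fun m => v m x) atTop (𝓝 (g x)) := by
    have h := ae_tendsto_edist_of_measure_le hk
    filter_upwards [(absolutelyContinuous_toFinite μ).ae_le h, hGg] with x h1 h2
    rw [tendsto_iff_edist_tendsto_0] at h2 ⊢
    refine tendsto_of_tendsto_of_tendsto_of_le_of_le tendsto_const_nhds
      (by simpa using h1.add h2) (fun _ => zero_le) fun m => edist_triangle _ _ _
  have hgm : AEStronglyMeasurable g μ :=
    aestronglyMeasurable_of_tendsto_ae atTop (fun m => Lp.aestronglyMeasurable (v m)) hvg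
  have hqv : ∀ m, q (v m) ≤ 2⁻¹ ^ m * 2 := fun m => calc
    q (v m) ≤ ∑ i ∈ Finset.range (k m + 1), q (u (m + i)) := hBD.partialSups_le hq _ _
    _ ≤ ∑ i ∈ Finset.range (k m + 1), 2⁻¹ ^ m * 2⁻¹ ^ i := by
      gcongr with i; rw [← pow_add]; exact hu _
    _ ≤ ∑' i, 2⁻¹ ^ m * 2⁻¹ ^ i := ENNReal.sum_le_tsum _
    _ = 2⁻¹ ^ m * 2 := by rw [ENNReal.tsum_mul_left, tsum_two_inv_pow]
  have hzero : AEEqFun.mk g hgm = 0 := by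
    refine hker _ (extendedForm_eq_zero_of_tendsto hq (v := v) (fun m => ?_) ?_ ?_)
    · exact (hqv m).trans_lt (ENNReal.mul_lt_top (ENNReal.pow_lt_top (by simp)) (by simp))
    · refine tendsto_of_tendsto_of_tendsto_of_le_of_le tendsto_const_nhds ?_
        (fun _ => zero_le) hqv
      simpa using ENNReal.Tendsto.mul_const tendsto_two_inv_pow (b := 2) (Or.inr (by simp))
    · refine tendstoL0_of_tendsto_ae ?_
      filter_upwards [hvg, AEEqFun.coeFn_mk g hgm] with x h1 h2
      rwa [h2]
  have hg0 : g =ᵐ[μ] 0 := by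
    have := AEEqFun.coeFn_mk g hgm
    rw [hzero] at this
    exact this.symm.trans AEEqFun.coeFn_zero
  filter_upwards [hGg, hg0, huG, hpos] with x h1 h2 h3 h4
  rw [h2] at h1
  exact tendsto_of_tendsto_of_tendsto_of_le_of_le tendsto_const_nhds h1 h4 h3

/-- Functions that are dominated by a fixed one and approximable by functions of small energy
have small weighted norm. -/
lemma exists_lintegral_lt_of_form_le [SigmaFinite μ] (hq : IsQuadForm q)
    (hBD : FirstBeurlingDeny q) (hker : ∀ f : X →ₘ[μ] ℝ, extendedForm q f = 0 → f = 0)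
    {h w : X → ℝ} (hwm : AEMeasurable w μ)
    (hhw : ∫⁻ x, ENNReal.ofReal (|h x| ^ 2 * w x) ∂μ ≠ ∞) (wpos : ∀ᵐ x ∂μ, 0 < w x)
    {r : ℝ≥0∞} (hr : 0 < r) :
    ∃ δ : ℝ≥0∞, 0 < δ ∧ δ ≠ ∞ ∧ ∀ (g : X → ℝ) (u : Lp ℝ 2 μ), AEStronglyMeasurable g μ →
      (∀ᵐ x ∂μ, |g x| ≤ |h x|) → q u ≤ δ →
      μ.toFinite {x | δ ≤ edist (u x) (g x)} ≤ δ →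
      ∫⁻ x, ENNReal.ofReal (|g x| ^ 2 * w x) ∂μ < r := by
  -- Failure for every `δ = 2⁻ⁿ` yields the two sequences.
  by_contra! hcon
  choose g u hgm hgh hqu hνu hint using fun n : ℕ =>
    hcon (2⁻¹ ^ n) (ENNReal.pow_pos (by simp) n) (ENNReal.pow_ne_top (by simp))
  have hug : ∀ᵐ x ∂μ, Tendsto (fun n => edist (u n x) (g n x)) atTop (𝓝 0) :=
    (absolutelyContinuous_toFinite μ).ae_le (ae_tendsto_edist_of_measure_le hνu)
  have hug' : ∀ᵐ x ∂μ, Tendsto (fun n => |((|u n| : Lp ℝ 2 μ) x - |g n x|)|) atTop (𝓝 0) := by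
    filter_upwards [hug, ae_all_iff.2 fun n => Lp.coeFn_abs (u n)] with x hx habs
    have hx' : Tendsto (fun n => dist (u n x) (g n x)) atTop (𝓝 0) := by
      simpa [Function.comp_def, edist_dist, ENNReal.toReal_ofReal] using
        (ENNReal.tendsto_toReal ENNReal.zero_ne_top).comp hx
    refine squeeze_zero (fun _ => abs_nonneg _) (fun n => ?_) hx'
    rw [habs n, Real.dist_eq]
    exact abs_abs_sub_abs_le _ _
  have hgh' := ae_all_iff.2 hgh
  have hu0 : ∀ᵐ x ∂μ, Tendsto (fun n => (|u n| : Lp ℝ 2 μ) x) atTop (𝓝 0) := by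
    refine ae_tendsto_zero_of_form_le hq hBD hker (fun n => (hBD _).trans (hqu n)) ?_ ?_
    · filter_upwards [ae_all_iff.2 fun n => Lp.coeFn_abs (u n)] with x habs n
      rw [habs n]; exact abs_nonneg _
    · filter_upwards [hug', hgh'] with x hx hb
      obtain ⟨C, hC⟩ := hx.bddAbove_range
      refine ⟨C + |h x|, forall_mem_range.2 fun n => ?_⟩
      have h1 := hC (mem_range_self n)
      have h2 := le_abs_self ((|u n| : Lp ℝ 2 μ) x - |g n x|)
      have h3 := hb n
      linarith
  have hg0 : ∀ᵐ x ∂μ, Tendsto (fun n => |g n x|) atTop (𝓝 0) := by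
    filter_upwards [hug', hu0] with x h1 h2
    have := h2.sub (tendsto_zero_iff_abs_tendsto_zero _ |>.2 h1)
    simpa using this
  have hlim := tendsto_lintegral_of_dominated_convergence'
    (μ := μ) (F := fun n x => ENNReal.ofReal (|g n x| ^ 2 * w x)) (f := fun _ => 0) _
    (fun n => (((hgm n).aemeasurable.abs.pow_const 2).mul hwm).ennreal_ofReal)
    (fun n => by
      filter_upwards [hgh n, wpos] with x h1 h2
      exact ENNReal.ofReal_le_ofReal (mul_le_mul_of_nonneg_right
        (pow_le_pow_left₀ (abs_nonneg _) h1 2) h2.le)) hhw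
    (by
      filter_upwards [hg0] with x hx
      simpa using ENNReal.tendsto_ofReal ((hx.pow 2).mul_const (w x)))
  rw [lintegral_zero] at hlim
  exact hr.not_ge (ge_of_tendsto' hlim hint)

end Main

/-! ### Scaling and the choice of the rate function -/

section WeakInequality

variable {X : Type*} [MeasurableSpace X] {μ : Measure X} {q : Lp ℝ 2 μ → ℝ≥0∞}

lemma ae_abs_le_of_eLpNorm_div {f h : X → ℝ} (hpos : ∀ᵐ x ∂μ, 0 < h x)
    (hfin : eLpNorm (fun x => f x / h x) ∞ μ ≠ ∞) :
    ∀ᵐ x ∂μ, |f x| ≤ (eLpNorm (fun x => f x / h x) ∞ μ).toReal * h x := by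
  have h1 := ae_le_eLpNormEssSup (f := fun x => f x / h x) (μ := μ)
  rw [← eLpNorm_exponent_top] at h1
  filter_upwards [h1, hpos] with x hx hp
  have := ENNReal.toReal_mono hfin hx
  rwa [toReal_enorm, Real.norm_eq_abs, abs_div, abs_of_pos hp, div_le_iff₀ hp] at this

lemma lintegral_sq_mul_of_integrable_withDensity {h w : X →ₘ[μ] ℝ}
    (hw : Integrable w (μ.withDensity fun x => ENNReal.ofReal (1 + h x ^ 2))) :
    ∫⁻ x, ENNReal.ofReal (|h x| ^ 2 * w x) ∂μ ≠ ∞ := by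
  have hfin := hw.2
  rw [HasFiniteIntegral, lintegral_withDensity_eq_lintegral_mul₀
    (by fun_prop) (by fun_prop)] at hfin
  refine (lt_of_le_of_lt (lintegral_mono fun x => ?_) hfin).ne
  rw [Pi.mul_apply, ← ofReal_norm, ← ENNReal.ofReal_mul (by positivity), sq_abs]
  refine ENNReal.ofReal_le_ofReal ?_
  have := le_abs_self (w x)
  rw [Real.norm_eq_abs]
  nlinarith [sq_nonneg (h x), abs_nonneg (w x)]

lemma lintegral_abs_mul_sq_mul (c : ℝ) (f w : X → ℝ) :
    ∫⁻ x, ENNReal.ofReal (|c * f x| ^ 2 * w x) ∂μ =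
      ENNReal.ofReal (c ^ 2) * ∫⁻ x, ENNReal.ofReal (|f x| ^ 2 * w x) ∂μ := by
  rw [← lintegral_const_mul' _ _ ENNReal.ofReal_ne_top]
  refine lintegral_congr fun x => ?_
  rw [← ENNReal.ofReal_mul (sq_nonneg c), abs_mul, mul_pow, sq_abs c, mul_assoc]

/-- The weak inequality at a fixed level `r`. -/
lemma exists_nat_weak_inequality [SigmaFinite μ] (hq : IsQuadForm q)
    (hBD : FirstBeurlingDeny q) (hker : ∀ f : X →ₘ[μ] ℝ, extendedForm q f = 0 → f = 0)
    {h w : X →ₘ[μ] ℝ} (hpos : ∀ᵐ x ∂μ, 0 < h x) (wpos : ∀ᵐ x ∂μ, 0 < w x)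
    (hw : Integrable w (μ.withDensity fun x => ENNReal.ofReal (1 + h x ^ 2)))
    {r : ℝ} (hr : 0 < r) :
    ∃ N : ℕ, ∀ f : X →ₘ[μ] ℝ, extendedForm q f < ∞ →
      ∫⁻ x, ENNReal.ofReal (|f x| ^ 2 * w x) ∂μ ≤
        N * extendedForm q f + ENNReal.ofReal r * eLpNorm (fun x => f x / h x) ∞ μ ^ 2 := by
  have hK := lintegral_sq_mul_of_integrable_withDensity hw
  obtain ⟨δ, hδ, hδt, hlt⟩ := exists_lintegral_lt_of_form_le hq hBD hker
    w.aemeasurable hK wpos (ENNReal.ofReal_pos.2 hr)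
  set K := ∫⁻ x, ENNReal.ofReal (|h x| ^ 2 * w x) ∂μ
  -- `N` exceeds `K / δ`, the cost of the trivial bound `M² K` per unit of energy when the energy is
  -- at least `M² δ`.
  obtain ⟨N, hN⟩ := ENNReal.exists_nat_gt (ENNReal.div_ne_top hK hδ.ne')
  refine ⟨N, fun f _ => ?_⟩
  set B := eLpNorm (fun x => f x / h x) ∞ μ
  rcases eq_or_ne B ∞ with hB | hB
  · simp [hB, ENNReal.mul_top, hr]
  have hfh : ∀ᵐ x ∂μ, |f x| ≤ B.toReal * h x := ae_abs_le_of_eLpNorm_div hpos hB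
  set M := B.toReal
  have hM0 : 0 ≤ M := ENNReal.toReal_nonneg
  have hBM : B ^ 2 = ENNReal.ofReal (M ^ 2) := by
    rw [ENNReal.ofReal_pow hM0, ENNReal.ofReal_toReal hB]
  have hIK : ∫⁻ x, ENNReal.ofReal (|f x| ^ 2 * w x) ∂μ ≤ ENNReal.ofReal (M ^ 2) * K := by
    rw [← lintegral_abs_mul_sq_mul]
    refine lintegral_mono_ae ?_
    filter_upwards [hfh, wpos] with x h1 h2
    exact ENNReal.ofReal_le_ofReal (mul_le_mul_of_nonneg_right
      (pow_le_pow_left₀ (abs_nonneg _) (h1.trans (le_abs_self _)) 2) h2.le)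
  rcases hM0.eq_or_lt with hM | hM
  · rw [← hM] at hIK
    exact (hIK.trans (by simp)).trans zero_le
  rcases le_or_gt (ENNReal.ofReal (M ^ 2) * δ) (extendedForm q f) with hbig | hsmall
  · refine hIK.trans (le_add_right ?_)
    calc ENNReal.ofReal (M ^ 2) * K = K / δ * (ENNReal.ofReal (M ^ 2) * δ) := by
          rw [mul_left_comm, ENNReal.div_mul_cancel hδ.ne' hδt]
      _ ≤ N * extendedForm q f := by gcongr
  · obtain ⟨u, hqu, hu⟩ := exists_isFormCauchy_of_extendedForm_lt hsmall
    have hMe : ENNReal.ofReal M ≠ 0 := (ENNReal.ofReal_pos.2 hM).ne'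
    -- The threshold `M δ` becomes `δ` after division by `M`.
    obtain ⟨k, hk⟩ := hu.exists_measure_le (toFinite_absolutelyContinuous μ)
      (ENNReal.mul_pos hMe hδ.ne') hδ
    have hcM : ENNReal.ofReal (M⁻¹ ^ 2) * ENNReal.ofReal (M ^ 2) = 1 := by
      rw [← ENNReal.ofReal_mul (by positivity), ← mul_pow, inv_mul_cancel₀ hM.ne']
      simp
    have hres := hlt (fun x => M⁻¹ * f x) (M⁻¹ • u k) (f.aestronglyMeasurable.const_mul _)
      (by
        filter_upwards [hfh, hpos] with x h1 h2
        rw [abs_mul, abs_of_pos (inv_pos.2 hM), inv_mul_le_iff₀ hM, abs_of_pos h2]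
        exact h1)
      (by
        rw [hq.smul]
        calc _ ≤ ENNReal.ofReal (M⁻¹ ^ 2) * (ENNReal.ofReal (M ^ 2) * δ) := by
              gcongr; exact (hqu k).le
          _ = δ := by rw [← mul_assoc, hcM, one_mul])
      (by
        refine le_trans (measure_mono_ae ?_) hk
        filter_upwards [(toFinite_absolutelyContinuous μ).ae_le (Lp.coeFn_smul M⁻¹ (u k))]
          with x hx hle
        change δ ≤ edist ((M⁻¹ • u k : Lp ℝ 2 μ) x) (M⁻¹ * f x) at hle
        change ENNReal.ofReal M * δ ≤ edist (u k x) (f x)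
        rw [hx, Pi.smul_apply, ← smul_eq_mul, edist_dist, dist_smul₀,
          Real.norm_eq_abs, abs_of_pos (inv_pos.2 hM),
          ENNReal.ofReal_mul (inv_nonneg.2 hM0), ← edist_dist] at hle
        calc _ ≤ ENNReal.ofReal M * (ENNReal.ofReal M⁻¹ * edist (u k x) (f x)) := by gcongr
          _ = edist (u k x) (f x) := by
            rw [← mul_assoc, ← ENNReal.ofReal_mul hM0, mul_inv_cancel₀ hM.ne',
              ENNReal.ofReal_one, one_mul])
    rw [lintegral_abs_mul_sq_mul] at hres
    refine le_add_left ?_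
    rw [hBM]
    calc ∫⁻ x, ENNReal.ofReal (|f x| ^ 2 * w x) ∂μ
        = ENNReal.ofReal (M ^ 2) * (ENNReal.ofReal (M⁻¹ ^ 2) *
            ∫⁻ x, ENNReal.ofReal (|f x| ^ 2 * w x) ∂μ) := by
          rw [← mul_assoc, mul_comm (ENNReal.ofReal (M ^ 2)), hcM, one_mul]
      _ ≤ ENNReal.ofReal (M ^ 2) * ENNReal.ofReal r := by gcongr
      _ = _ := mul_comm _ _

end WeakInequality

theorem mainTheorem12 {X : Type*} [MeasurableSpace X] (μ : Measure X) [SigmaFinite μ]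
    (q : Lp ℝ 2 μ → ℝ≥0∞) (hq : IsQuadForm q) (hclosed : IsClosedForm q)
    (hBD : FirstBeurlingDeny q)
    (hker : {f : X →ₘ[μ] ℝ | extendedForm q f = 0} = {0})
    (h : X →ₘ[μ] ℝ) (hpos : ∀ᵐ x ∂μ, 0 < h x)
    (w : X →ₘ[μ] ℝ) (wpos : ∀ᵐ x ∂μ, 0 < w x)
    (hw : Integrable w (μ.withDensity fun x => ENNReal.ofReal (1 + h x ^ 2))) :
    ∃ α : ℝ → ℝ, (∀ r, 0 < r → 0 < α r) ∧ AntitoneOn α (Ioi 0) ∧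
      ∀ r, 0 < r → ∀ f : X →ₘ[μ] ℝ, extendedForm q f < ∞ →
        ∫⁻ x, ENNReal.ofReal (|f x| ^ 2 * w x) ∂μ ≤
          ENNReal.ofReal (α r) * extendedForm q f +
            ENNReal.ofReal r * eLpNorm (fun x => f x / h x) ∞ μ ^ 2 := by
  classical
  have hker' : ∀ f : X →ₘ[μ] ℝ, extendedForm q f = 0 → f = 0 := fun f hf => by
    have hmem : f ∈ {f : X →ₘ[μ] ℝ | extendedForm q f = 0} := hf
    rwa [hker] at hmem
  have key := fun r (hr : 0 < r) => exists_nat_weak_inequality hq hBD hker' hpos wpos hw hr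
  -- Taking the least admissible `N` makes `α` antitone, as what is admissible at `r` stays so at
  -- larger values; the `+ 1` gives positivity.
  let α : ℝ → ℝ := fun r => if hr : 0 < r then (Nat.find (key r hr) : ℝ) + 1 else 1
  have hα : ∀ r (hr : 0 < r), α r = Nat.find (key r hr) + 1 := fun r hr => dif_pos hr
  refine ⟨α, fun r hr => ?_, fun r hr s hs hrs => ?_, fun r hr f hf => ?_⟩
  · rw [hα r hr]; positivity
  · rw [hα r hr, hα s hs]
    gcongr
    refine Nat.find_min' _ fun f hf => (Nat.find_spec (key r hr) f hf).trans ?_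
    gcongr
  · refine (Nat.find_spec (key r hr) f hf).trans ?_
    gcongr
    rw [hα r hr, ← ENNReal.ofReal_natCast]
    exact ENNReal.ofReal_le_ofReal (by linarith)
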